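/- Let $d\ge 1$. Let $\mu$ be a probability distribution on $\{0,1,2,\dots\}$ with mean one and with some finite exponential moment, i.e. $\sum_n e^{an}\mu(n)<\infty$ for some $a>0$, and let $\theta$ be a centered probability distribution on $\mathbb Z^d$ whose support is exactly the set of the $2d$ neighbors of the origin. Let $\mathcal T$ be a Bienaymé–Galton–Watson tree with offspring distribution $\mu$, and, for $x\in\mathbb Z^d$, let $\mathbb E_x$ be the expectation for the branching random walk $\{S_u\}_{u\in\mathcal T}$ started at $x$: independently of $\mathcal T$, i.i.d. increments of law $\theta$ are attached to the edges of $\mathcal T$, and $S_u$ is the sum of $x$ and of the increments along the path from the root to $u$. For $r>0$ let $B_r=\{z\in\mathbb Z^d:\|z\|<r\}$ ($\|\cdot\|$ the Euclidean norm), and let $$\mathcal T(B_r)=\{u\in\mathcal T:\ S_v\in B_r\text{ for every ancestor } v \text{ of } u,\ u \text{ included}\}$$ be the set of particles of the walk killed on leaving $B_r$. Then there exist constants $c>0$ and $\lambda_0>0$ (depending only on $d$, $\mu$ and $\theta$) such that for every $0\le\lambda\le\lambda_0$ and every real $r\ge 1$, $$\sup_{x\in B_r}\ \mathbb E_x\Big[\exp\Big(\lambda\,\frac{|\mathcal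 T(B_r)|}{r^4}\Big)\Big]\ \le\ \exp\Big(\frac{c\lambda}{r^2}\Big).$$ -/

import Mathlib

open MeasureTheory
open scoped ENNReal

noncomputable section

namespace BRW

/-- The Euclidean norm of a point of the lattice `ℤ^d`. -/
def latticeNorm {d : ℕ} (z : Fin d → ℤ) : ℝ :=
  ‖(WithLp.toLp 2 (fun i => (z i : ℝ)) : EuclideanSpace ℝ (Fin d))‖

/-- The open Euclidean ball `B_r = {z ∈ ℤ^d : ‖z‖ < r}` centred at the origin. -/
def latticeBall (d : ℕ) (r : ℝ) : Set (Fin d → ℤ) :=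
  {z | latticeNorm z < r}

/-- The offspring law `μ` is critical: its mean is one. -/
def IsCritical (μ : PMF ℕ) : Prop :=
  ∑' n : ℕ, (n : ℝ≥0∞) * μ n = 1

/-- The offspring law `μ` has some finite exponential moment. -/
def HasExpMoment (μ : PMF ℕ) : Prop :=
  ∃ a : ℝ, 0 < a ∧ ∑' n : ℕ, ENNReal.ofReal (Real.exp (a * n)) * μ n < ∞

/-- The jump law `θ` is centred, and its support is exactly the set of the
neighbours of the origin. -/
structure IsNearestNeighbourLaw {d : ℕ} (θ : PMF (Fin d → ℤ)) : Prop where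
  support_eq : θ.support = {z | latticeNorm z = 1}
  centered : ∀ i : Fin d, HasSum (fun z : Fin d → ℤ => (z i : ℝ) * (θ z).toReal) 0

/-- Potential vertices are finite words of natural numbers (Ulam--Harris labels): the root is
the empty word, the children of `u` are the words `u ++ [i]`, and `v` is an ancestor of `u`
(possibly `u` itself) when `v` is a prefix of `u`. A sample point attaches to each word `u`
the number of children of `u` and the jump along the edge from the parent of `u` to `u`
(the jump attached to the root is not used). -/
abbrev Sample (d : ℕ) : Type := List ℕ → ℕ × (Fin d → ℤ)

/-- The law of the family of offspring numbers (each of law `μ`) and jumps (each of law `θ`),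
all of them independent. -/
def law {d : ℕ} (μ : PMF ℕ) (θ : PMF (Fin d → ℤ)) : Measure (Sample d) :=
  Measure.infinitePi (fun _ : List ℕ => μ.toMeasure.prod θ.toMeasure)

/-- The number of children of `u`. -/
def offspring {d : ℕ} (ω : Sample d) (u : List ℕ) : ℕ := (ω u).1

/-- The jump along the edge from the parent of `u` to `u`. -/
def jump {d : ℕ} (ω : Sample d) (u : List ℕ) : Fin d → ℤ := (ω u).2

/-- The Bienaymé--Galton--Watson tree: the word `u = u₀ u₁ ⋯` is a vertex when each of its
letters `u_k` is less than the number of children of the prefix of length `k`. -/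
def tree {d : ℕ} (ω : Sample d) : Set (List ℕ) :=
  {u | ∀ (k : ℕ) (hk : k < u.length), u[k] < offspring ω (u.take k)}

/-- The position `S_u` of the walk started at `x`: the sum of `x` and of the jumps along the
edges from the root to `u`. -/
def position {d : ℕ} (ω : Sample d) (x : Fin d → ℤ) (u : List ℕ) : Fin d → ℤ :=
  x + ∑ k ∈ Finset.range u.length, jump ω (u.take (k + 1))

/-- `𝒯(Λ)`: the vertices of the tree at which the walk started at `x` is in `Λ`, as well as
at all the ancestors. -/
def killedTree {d : ℕ} (ω : Sample d) (x : Fin d → ℤ) (Λ : Set (Fin d → ℤ)) :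
    Set (List ℕ) :=
  {u | u ∈ tree ω ∧ ∀ v : List ℕ, v <+: u → position ω x v ∈ Λ}

/-- `E_x[exp(s |𝒯(Λ)|)]`, as an element of `[0, ∞]`. -/
def expMomentKilled {d : ℕ} (μ : PMF ℕ) (θ : PMF (Fin d → ℤ)) (x : Fin d → ℤ)
    (Λ : Set (Fin d → ℤ)) (s : ℝ) : ℝ≥0∞ :=
  ∫⁻ ω, EReal.exp ((s : EReal) * (((killedTree ω x Λ).encard : ℝ≥0∞) : EReal)) ∂(law μ θ)

end BRW

end

namespace BRW

/-! With s = λ/r⁴, let h_n(x) be the exponential moment of the killed tree cut at generation n.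
Branching gives h_{n+1}(x) = e^s E_μ[(E_θ h_n(x + ·))^k] on the ball (k the offspring number), and
h_n = 1 outside it (`lintegral_weight_succ`). The parabola f(x) = 1 + 4s((r+1)² - ‖x‖²) is a
supersolution of this recursion. Averaging over one jump lowers it by exactly 4s
(`lintegral_parabola`). By criticality, the generating function of μ at 1 + t is at most 1 + t + Kt²
(`exists_lintegral_pow_le`). Here t = O(s r²), so Kt² = O(s · s r⁴) is at most s/2 when λ = s r⁴ is
small, and the gain 4s pays for both this and the factor e^s. Induction on n gives h_n ≤ f
(`lintegral_weight_le`); monotone convergence removes the truncation, and f ≤ 1 + 16 s r² ≤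
exp(16λ/r²). -/

/-! ### Branching property of the labelled tree. -/

/-- The sample seen from the `i`-th child of the root. -/
def subsample {d : ℕ} (i : ℕ) (ω : Sample d) : Sample d := fun u => ω (i :: u)

lemma measurable_subsample {d : ℕ} (i : ℕ) : Measurable (subsample (d := d) i) := by
  unfold subsample; fun_prop

instance {d : ℕ} (μ : PMF ℕ) (θ : PMF (Fin d → ℤ)) : IsProbabilityMeasure (law μ θ) := by
  unfold law; infer_instance

/-- Sample whose root label is the root label of `ρ none` and whose `i`-th subsample is
`ρ (some i)`. -/
def graft {d : ℕ} (ρ : Option ℕ → Sample d) : Sample d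
  | [] => ρ none []
  | i :: u => ρ (some i) u

/-- Grafting reads an i.i.d. family indexed by `Option ℕ × List ℕ` along the injection `e`, and a
reindexing along an injection is again i.i.d. -/
lemma map_graft {d : ℕ} (μ : PMF ℕ) (θ : PMF (Fin d → ℤ)) :
    (Measure.infinitePi (fun _ : Option ℕ => law μ θ)).map graft = law μ θ := by
  let e : List ℕ → Option ℕ × List ℕ
    | [] => (none, [])
    | i :: u => (some i, u)
  have he : Function.Injective e := by
    rintro (_ | ⟨i, u⟩) (_ | ⟨j, v⟩) h <;> simp_all [e]
  have h1 := Measure.map_infinitePi_infinitePi_of_inj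
    (P := fun _ : Option ℕ × List ℕ => μ.toMeasure.prod θ.toMeasure) he
  have h2 := Measure.infinitePi_map_curry_symm
    (fun (_ : Option ℕ) (_ : List ℕ) => μ.toMeasure.prod θ.toMeasure)
  rw [← h2, Measure.map_map (by fun_prop) (by fun_prop)] at h1
  unfold law
  refine Eq.trans ?_ h1
  congr 1
  ext ρ u : 2
  cases u <;> rfl

lemma measurable_graft {d : ℕ} : Measurable (graft (d := d)) := by
  refine measurable_pi_iff.2 fun u => ?_
  cases u <;> simp only [graft] <;> fun_prop

lemma law_root {d : ℕ} (μ : PMF ℕ) (θ : PMF (Fin d → ℤ)) (u : List ℕ) :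
    (law μ θ).map (fun ω => ω u) = μ.toMeasure.prod θ.toMeasure :=
  Measure.infinitePi_map_eval _ u

/-- The branching property: given the label of the root, the subsamples seen from its children are
independent copies of the sample. -/
lemma lintegral_branching {d : ℕ} (μ : PMF ℕ) (θ : PMF (Fin d → ℤ))
    (F : ℕ × (Fin d → ℤ) → ℝ≥0∞) (g : ℕ × (Fin d → ℤ) → Sample d → ℝ≥0∞)
    (hg : ∀ p, Measurable (g p)) :
    ∫⁻ ω, F (ω []) * ∏ i ∈ Finset.range (ω []).1, g (ω []) (subsample i ω) ∂(law μ θ)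
      = ∫⁻ p, F p * (∫⁻ ω, g p ω ∂(law μ θ)) ^ p.1 ∂(μ.toMeasure.prod θ.toMeasure) := by
  -- With the root label frozen at p, the number of factors is deterministic and independence
  -- applies; summing over the countably many p gives the claim.
  have hfix : ∀ p : ℕ × (Fin d → ℤ),
      ∫⁻ ω, ({p} : Set (ℕ × (Fin d → ℤ))).indicator 1 (ω []) *
          ∏ i ∈ Finset.range p.1, g p (subsample i ω) ∂(law μ θ)
        = (μ.toMeasure.prod θ.toMeasure) {p} * (∫⁻ ω, g p ω ∂(law μ θ)) ^ p.1 := by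
    intro p
    let X : Option ℕ → Sample d → ℝ≥0∞ := fun o ω =>
      o.elim (({p} : Set (ℕ × (Fin d → ℤ))).indicator 1 (ω [])) (fun _ => g p ω)
    have hind : Measurable (fun ω : Sample d =>
        ({p} : Set (ℕ × (Fin d → ℤ))).indicator (1 : ℕ × (Fin d → ℤ) → ℝ≥0∞) (ω [])) :=
      (measurable_one.indicator (measurableSet_singleton p)).comp (measurable_pi_apply _)
    have hX : ∀ o, Measurable (X o) := by
      rintro (_ | i)
      · exact hind
      · exact hg p
    have key := ProbabilityTheory.lintegral_prod_eq_prod_lintegral_of_indepFun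
      (Finset.insertNone (Finset.range p.1)) _
      (ProbabilityTheory.iIndepFun_infinitePi (P := fun _ : Option ℕ => law μ θ) hX)
      (fun o => (hX o).comp (measurable_pi_apply o))
    have heval : ∀ o, ∫⁻ ρ, X o (ρ o) ∂(Measure.infinitePi (fun _ : Option ℕ => law μ θ))
        = ∫⁻ ω, X o ω ∂(law μ θ) := fun o =>
      (measurePreserving_eval_infinitePi (fun _ : Option ℕ => law μ θ) o).lintegral_comp (hX o)
    simp only [heval, Finset.prod_insertNone] at key
    have hroot : ∫⁻ ω, X none ω ∂(law μ θ) = (μ.toMeasure.prod θ.toMeasure) {p} := by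
      rw [← law_root μ θ [], ← lintegral_indicator_one (measurableSet_singleton p),
        lintegral_map (measurable_one.indicator (measurableSet_singleton p))
          (measurable_pi_apply _)]
      rfl
    rw [hroot] at key
    conv_lhs => rw [← map_graft μ θ]
    rw [lintegral_map _ measurable_graft]
    · have hsub : ∀ i ρ, subsample (d := d) i (graft ρ) = ρ (some i) := fun _ _ => rfl
      simpa [X, hsub, graft] using key
    · exact hind.mul (Finset.measurable_prod _ fun i _ => (hg p).comp (measurable_subsample i))
  have hsplit : ∀ ω : Sample d,
      F (ω []) * ∏ i ∈ Finset.range (ω []).1, g (ω []) (subsample i ω)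
        = ∑' p, F p * (({p} : Set (ℕ × (Fin d → ℤ))).indicator 1 (ω []) *
          ∏ i ∈ Finset.range p.1, g p (subsample i ω)) := by
    intro ω
    rw [tsum_eq_single (ω [])]
    · simp
    · intro p hp
      simp [Ne.symm hp]
  have hmeas : ∀ p : ℕ × (Fin d → ℤ), Measurable fun ω : Sample d =>
      ({p} : Set (ℕ × (Fin d → ℤ))).indicator 1 (ω []) *
          ∏ i ∈ Finset.range p.1, g p (subsample i ω) := fun p =>
    ((measurable_one.indicator (measurableSet_singleton p)).comp (measurable_pi_apply _)).mul
      (Finset.measurable_prod _ fun i _ => (hg p).comp (measurable_subsample i))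
  simp_rw [hsplit]
  rw [lintegral_tsum fun p => ((hmeas p).const_mul _).aemeasurable, lintegral_countable']
  refine tsum_congr fun p => ?_
  rw [lintegral_const_mul _ (hmeas p), hfix]
  ring

/-! ### Truncated counts of the killed tree. -/

open Classical in
/-- The number of vertices of generation less than `n` of the killed tree. -/
noncomputable def killedCount {d : ℕ} (Λ : Set (Fin d → ℤ)) : ℕ → Sample d → (Fin d → ℤ) → ℕ
  | 0, _, _ => 0
  | n + 1, ω, x => if x ∈ Λ then 1 + ∑ i ∈ Finset.range (ω []).1,
      killedCount Λ n (subsample i ω) (x + (subsample i ω []).2) else 0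

lemma killedCount_le_succ {d : ℕ} (Λ : Set (Fin d → ℤ)) (n : ℕ) :
    ∀ (ω : Sample d) (x : Fin d → ℤ), killedCount Λ n ω x ≤ killedCount Λ (n + 1) ω x := by
  induction n with
  | zero => intro ω x; simp [killedCount]
  | succ n ih =>
    intro ω x
    rw [killedCount, killedCount]
    split_ifs
    · gcongr
      exact ih _ _
    · rfl

lemma measurable_killedCount {d : ℕ} (Λ : Set (Fin d → ℤ)) (n : ℕ) :
    Measurable fun p : Sample d × (Fin d → ℤ) => killedCount Λ n p.1 p.2 := by
  induction n with
  | zero => simp only [killedCount]; fun_prop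
  | succ n ih =>
    refine measurable_from_prod_countable_left fun x => ?_
    by_cases hx : x ∈ Λ
    · simp only [killedCount, hx, if_true]
      have h : Measurable fun q : ℕ × Sample d => 1 + ∑ i ∈ Finset.range q.1,
          killedCount Λ n (subsample i q.2) (x + (subsample i q.2 []).2) := by
        refine measurable_from_prod_countable_right fun k => ?_
        simp only
        refine measurable_const.add (Finset.measurable_fun_sum _ fun i _ => ?_)
        have hs := measurable_subsample (d := d) i
        exact ih.comp (hs.prodMk (measurable_const.add
          ((measurable_pi_apply ([] : List ℕ)).comp hs).snd))
      have h0 : Measurable fun ω : Sample d => ((ω []).1, ω) := by fun_prop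
      exact h.comp h0
    · simp only [killedCount, hx, if_false]
      fun_prop

lemma position_cons {d : ℕ} (ω : Sample d) (x : Fin d → ℤ) (i : ℕ) (u : List ℕ) :
    position ω x (i :: u) = position (subsample i ω) (x + (subsample i ω []).2) u := by
  simp only [position, List.length_cons, Finset.sum_range_succ', jump, subsample]
  simp only [List.take_succ_cons, List.take_zero]
  abel

lemma mem_of_mem_killedTree {d : ℕ} {ω : Sample d} {x : Fin d → ℤ} {Λ : Set (Fin d → ℤ)}
    {u : List ℕ} (h : u ∈ killedTree ω x Λ) : x ∈ Λ := by
  simpa [position] using h.2 [] u.nil_prefix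

lemma killedTree_cons {d : ℕ} {ω : Sample d} {x : Fin d → ℤ} {Λ : Set (Fin d → ℤ)}
    {i : ℕ} {u : List ℕ} (h : i :: u ∈ killedTree ω x Λ) :
    i < (ω []).1 ∧ u ∈ killedTree (subsample i ω) (x + (subsample i ω []).2) Λ := by
  refine ⟨h.1 0 (by simp), fun k hk => ?_, fun v hv => ?_⟩
  · exact h.1 (k + 1) (by simpa using hk)
  · rw [← position_cons]
    exact h.2 _ (by simpa using hv)

lemma encard_killedTree_le {d : ℕ} (Λ : Set (Fin d → ℤ)) (n : ℕ) :
    ∀ (ω : Sample d) (x : Fin d → ℤ),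
      {u ∈ killedTree ω x Λ | u.length < n}.encard ≤ killedCount Λ n ω x := by
  induction n with
  | zero => intro ω x; simp
  | succ n ih =>
    intro ω x
    by_cases hx : x ∈ Λ
    · have hsub : {u ∈ killedTree ω x Λ | u.length < n + 1} ⊆ {[]} ∪
          ⋃ i ∈ Finset.range (ω []).1, List.cons i ''
            {u ∈ killedTree (subsample i ω) (x + (subsample i ω []).2) Λ | u.length < n} := by
        rintro (_ | ⟨i, u⟩) ⟨hu, hl⟩
        · simp
        · have := killedTree_cons hu
          right
          simp only [Set.mem_iUnion]
          exact ⟨i, by simpa using this.1, u, ⟨this.2, by simpa using hl⟩, rfl⟩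
      rw [killedCount, if_pos hx]
      push_cast
      refine (Set.encard_le_encard hsub).trans ((Set.encard_union_le _ _).trans ?_)
      rw [Set.encard_singleton]
      gcongr
      refine (Finset.set_encard_biUnion_le _ _).trans (Finset.sum_le_sum fun i _ => ?_)
      exact (Set.encard_image_le _ _).trans (ih _ _)
    · rw [Set.encard_eq_zero.2]
      · exact zero_le
      · exact Set.eq_empty_of_forall_notMem fun u hu => hx (mem_of_mem_killedTree hu.1)

lemma exists_le_killedCount {d : ℕ} {ω : Sample d} {x : Fin d → ℤ} {Λ : Set (Fin d → ℤ)} {m : ℕ}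
    (hm : (m : ℕ∞) ≤ (killedTree ω x Λ).encard) : ∃ n, m ≤ killedCount Λ n ω x := by
  obtain ⟨t, ht, hcard⟩ := Set.exists_subset_encard_eq hm
  have hfin : t.Finite := Set.finite_of_encard_eq_coe hcard
  obtain ⟨N, hN⟩ := (hfin.image List.length).bddAbove
  refine ⟨N + 1, ?_⟩
  have : t ⊆ {u ∈ killedTree ω x Λ | u.length < N + 1} := fun u hu =>
    ⟨ht hu, Nat.lt_succ_of_le (hN ⟨u, hu, rfl⟩)⟩
  have h := (Set.encard_le_encard this).trans (encard_killedTree_le Λ (N + 1) ω x)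
  rw [hcard] at h
  exact_mod_cast h

/-! ### Exponential weights and their recursion. -/

/-- The weight `exp (s N)`, with `N` the number of killed vertices of generation less than `n`. -/
noncomputable def weight {d : ℕ} (Λ : Set (Fin d → ℤ)) (s : ℝ) (n : ℕ) (ω : Sample d) (x : Fin d → ℤ) : ℝ≥0∞ :=
  ENNReal.ofReal (Real.exp (s * killedCount Λ n ω x))

/-- The starting point may depend on the root label because the jump leading to a child is stored in
the child's own label. -/
lemma measurable_weight {d : ℕ} (Λ : Set (Fin d → ℤ)) (s : ℝ) (n : ℕ)
    {z : ℕ × (Fin d → ℤ) → (Fin d → ℤ)} :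
    Measurable fun ω : Sample d => weight Λ s n ω (z (ω [])) := by
  have h1 : Measurable fun ω : Sample d => (ω, z (ω [])) :=
    measurable_id.prodMk ((measurable_of_countable z).comp (measurable_pi_apply []))
  have h2 := (measurable_killedCount Λ n).comp h1
  have h3 : Measurable fun k : ℕ => ENNReal.ofReal (Real.exp (s * k)) := measurable_of_countable _
  exact h3.comp h2

open Classical in
lemma weight_succ {d : ℕ} (Λ : Set (Fin d → ℤ)) (s : ℝ) (n : ℕ) (ω : Sample d)
    (x : Fin d → ℤ) :
    weight Λ s (n + 1) ω x =
      (if x ∈ Λ then ENNReal.ofReal (Real.exp s) else 1) * ∏ i ∈ Finset.range (ω []).1,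
        (if x ∈ Λ then weight Λ s n (subsample i ω) (x + (subsample i ω []).2) else 1) := by
  by_cases hx : x ∈ Λ
  · simp only [weight, killedCount, hx, if_true]
    rw [← ENNReal.ofReal_prod_of_nonneg (fun _ _ => (Real.exp_pos _).le),
      ← ENNReal.ofReal_mul (Real.exp_pos _).le, ← Real.exp_sum, ← Real.exp_add]
    push_cast
    rw [mul_add, mul_one, Finset.mul_sum]
  · simp [weight, killedCount, hx]

open Classical in
lemma lintegral_weight_succ {d : ℕ} (μ : PMF ℕ) (θ : PMF (Fin d → ℤ)) (Λ : Set (Fin d → ℤ))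
    (s : ℝ) (n : ℕ) (z : ℕ × (Fin d → ℤ) → (Fin d → ℤ)) :
    ∫⁻ ω, weight Λ s (n + 1) ω (z (ω [])) ∂(law μ θ) =
      ∫⁻ p, (if z p ∈ Λ then ENNReal.ofReal (Real.exp s) *
        (∫⁻ ω, weight Λ s n ω (z p + (ω []).2) ∂(law μ θ)) ^ p.1 else 1)
        ∂(μ.toMeasure.prod θ.toMeasure) := by
  simp_rw [weight_succ]
  rw [lintegral_branching μ θ (fun p => if z p ∈ Λ then ENNReal.ofReal (Real.exp s) else 1)
    (fun p ω => if z p ∈ Λ then weight Λ s n ω (z p + (ω []).2) else 1)]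
  · refine lintegral_congr fun p => ?_
    by_cases hp : z p ∈ Λ <;> simp [hp]
  · intro p
    by_cases hp : z p ∈ Λ
    · simpa [hp] using measurable_weight Λ s n (z := fun q => z p + q.2)
    · simp [hp]

lemma exp_encard_le_iSup_weight {d : ℕ} (Λ : Set (Fin d → ℤ)) {s : ℝ} (hs : 0 ≤ s)
    (ω : Sample d) (x : Fin d → ℤ) :
    EReal.exp ((s : EReal) * (((killedTree ω x Λ).encard : ℝ≥0∞) : EReal))
      ≤ ⨆ n, weight Λ s n ω x := by
  have hnat : ∀ m : ℕ, (m : ℕ∞) ≤ (killedTree ω x Λ).encard →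
      ENNReal.ofReal (Real.exp (s * m)) ≤ ⨆ n, weight Λ s n ω x := by
    intro m hm
    obtain ⟨n, hn⟩ := exists_le_killedCount hm
    refine le_iSup_of_le n (ENNReal.ofReal_le_ofReal (Real.exp_le_exp.2 ?_))
    gcongr
  rcases hs.eq_or_lt with rfl | hs'
  -- Treated apart because `0 * ⊤ = 0` in `EReal`: an infinite tree contributes exp 0 = 1.
  · simpa using hnat 0 (by simp)
  · cases hc : (killedTree ω x Λ).encard with
    | top =>
      refine le_top.trans (le_of_eq (Eq.symm ?_))
      refine ENNReal.eq_top_of_forall_nnreal_le fun q => ?_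
      obtain ⟨m, hm⟩ := exists_nat_ge ((q : ℝ) / s)
      refine le_trans ?_ (hnat m (by simp [hc]))
      rw [← ENNReal.ofReal_coe_nnreal]
      refine ENNReal.ofReal_le_ofReal ?_
      rw [div_le_iff₀ hs'] at hm
      linarith [Real.add_one_le_exp (s * m)]
    | coe m =>
      have h := hnat m hc.ge
      have h2 : (s : EReal) * (((((m : ℕ∞) : ℝ≥0∞)) : ℝ≥0∞) : EReal) = ((s * m : ℝ) : EReal) := by
        push_cast
        rfl
      rw [h2, EReal.exp_coe]
      exact h

/-- Monotone convergence in the truncation level. -/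
lemma expMomentKilled_le {d : ℕ} (μ : PMF ℕ) (θ : PMF (Fin d → ℤ)) (x : Fin d → ℤ)
    (Λ : Set (Fin d → ℤ)) {s : ℝ} (hs : 0 ≤ s) {C : ℝ≥0∞}
    (hC : ∀ n, ∫⁻ ω, weight Λ s (n + 1) ω x ∂(law μ θ) ≤ C) :
    expMomentKilled μ θ x Λ s ≤ C := by
  have hmono : Monotone fun n (ω : Sample d) => weight Λ s n ω x := by
    refine monotone_nat_of_le_succ fun n ω => ENNReal.ofReal_le_ofReal (Real.exp_le_exp.2 ?_)
    have := killedCount_le_succ Λ n ω x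
    gcongr
  refine (lintegral_mono fun ω => exp_encard_le_iSup_weight Λ hs ω x).trans ?_
  rw [lintegral_iSup (fun n => measurable_weight Λ s n (z := fun _ => x)) hmono]
  exact iSup_le fun n => (lintegral_mono (hmono n.le_succ)).trans (hC n)

/-! ### The offspring generating function to the right of 1. -/

/-- The Taylor remainder is at most (nt)² exp(nt). Half of exp(an) absorbs exp(nt), as t ≤ a/2; the
other half absorbs n² = (16/a²)(an/4)². -/
lemma one_add_pow_le {a t : ℝ} (ha : 0 < a) (ht : 0 ≤ t) (hta : t ≤ a / 2) (n : ℕ) :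
    (1 + t) ^ n ≤ 1 + n * t + 16 / a ^ 2 * t ^ 2 * Real.exp (a * n) := by
  have hn : (0 : ℝ) ≤ n := n.cast_nonneg
  have hx : 0 ≤ n * t := mul_nonneg hn ht
  have h1 : (1 + t) ^ n ≤ Real.exp (n * t) := by
    rw [Real.exp_nat_mul]
    gcongr
    linarith [Real.add_one_le_exp t]
  have h2 : Real.exp (n * t) ≤ 1 + n * t * Real.exp (n * t) := by
    have h := Real.add_one_le_exp (-(n * t))
    have := mul_le_mul_of_nonneg_right h (Real.exp_pos (n * t)).le
    rw [← Real.exp_add, neg_add_cancel, Real.exp_zero] at this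
    linarith
  have h3 : Real.exp (n * t) ≤ 1 + n * t + (n * t) ^ 2 * Real.exp (n * t) := by
    nlinarith [mul_le_mul_of_nonneg_left h2 hx]
  have h4 : (a * n / 4) ^ 2 ≤ Real.exp (a * n / 2) := by
    have h : a * n / 4 ≤ Real.exp (a * n / 4) := by linarith [Real.add_one_le_exp (a * n / 4)]
    calc (a * n / 4) ^ 2 ≤ Real.exp (a * n / 4) ^ 2 := by gcongr
      _ = Real.exp (a * n / 2) := by rw [← Real.exp_nat_mul]; congr 1; push_cast; ring
  have h5 : Real.exp (n * t) ≤ Real.exp (a * n / 2) := Real.exp_le_exp.2 (by nlinarith)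
  have h6 : (n : ℝ) ^ 2 * Real.exp (n * t) ≤ 16 / a ^ 2 * Real.exp (a * n) := by
    calc (n : ℝ) ^ 2 * Real.exp (n * t)
        = 16 / a ^ 2 * ((a * n / 4) ^ 2 * Real.exp (n * t)) := by field_simp; norm_num
      _ ≤ 16 / a ^ 2 * (Real.exp (a * n / 2) * Real.exp (a * n / 2)) := by gcongr
      _ = 16 / a ^ 2 * Real.exp (a * n) := by rw [← Real.exp_add]; congr 2; ring
  nlinarith [mul_le_mul_of_nonneg_left h6 (sq_nonneg t)]

/-- A second order bound, to the right of `1`, for the generating function of a critical offspring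
law with an exponential moment. -/
lemma exists_lintegral_pow_le {μ : PMF ℕ} (hμ : IsCritical μ) (hexp : HasExpMoment μ) :
    ∃ K t₀ : ℝ, 0 ≤ K ∧ 0 < t₀ ∧ ∀ t, 0 ≤ t → t ≤ t₀ →
      ∫⁻ n, ENNReal.ofReal (1 + t) ^ n ∂μ.toMeasure ≤ ENNReal.ofReal (1 + t + K * t ^ 2) := by
  obtain ⟨a, ha, hM⟩ := hexp
  set M := ∑' n : ℕ, ENNReal.ofReal (Real.exp (a * n)) * μ n with hMdef
  refine ⟨16 / a ^ 2 * M.toReal, a / 2, by positivity, by positivity, fun t ht hta => ?_⟩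
  have hk : 0 ≤ 16 / a ^ 2 * t ^ 2 := by positivity
  have hterm : ∀ n : ℕ, ENNReal.ofReal (1 + t) ^ n * μ.toMeasure {n} ≤
      μ n + ENNReal.ofReal t * (n * μ n) +
        ENNReal.ofReal (16 / a ^ 2 * t ^ 2) * (ENNReal.ofReal (Real.exp (a * n)) * μ n) := by
    intro n
    have hn : 0 ≤ (n : ℝ) * t := by positivity
    rw [PMF.toMeasure_apply_singleton _ _ (measurableSet_singleton n)]
    calc ENNReal.ofReal (1 + t) ^ n * μ n
        ≤ ENNReal.ofReal (1 + n * t + 16 / a ^ 2 * t ^ 2 * Real.exp (a * n)) * μ n := by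
          rw [← ENNReal.ofReal_pow (by positivity)]
          gcongr
          exact one_add_pow_le ha ht hta n
      _ = _ := by
          rw [ENNReal.ofReal_add (by positivity) (by positivity),
            ENNReal.ofReal_add (by positivity) hn, ENNReal.ofReal_mul hk,
            ENNReal.ofReal_mul n.cast_nonneg, ENNReal.ofReal_natCast, ENNReal.ofReal_one]
          ring
  rw [lintegral_countable']
  refine (ENNReal.tsum_le_tsum hterm).trans (le_of_eq ?_)
  rw [ENNReal.tsum_add, ENNReal.tsum_add, ENNReal.tsum_mul_left, ENNReal.tsum_mul_left,
    PMF.tsum_coe, ← hMdef, (hμ : ∑' n : ℕ, (n : ℝ≥0∞) * μ n = 1), mul_one]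
  conv_lhs => rw [← ENNReal.ofReal_toReal hM.ne, ← ENNReal.ofReal_mul hk, ← ENNReal.ofReal_one,
    ← ENNReal.ofReal_add zero_le_one ht, ← ENNReal.ofReal_add (by positivity) (by positivity)]
  congr 1
  ring

/-! ### The parabola under one jump. -/

lemma latticeNorm_sq {d : ℕ} (z : Fin d → ℤ) : latticeNorm z ^ 2 = ∑ i, (z i : ℝ) ^ 2 := by
  rw [latticeNorm, EuclideanSpace.norm_sq_eq]
  simp

lemma latticeNorm_nonneg {d : ℕ} (z : Fin d → ℤ) : 0 ≤ latticeNorm z := norm_nonneg _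

lemma latticeNorm_add_le {d : ℕ} (x y : Fin d → ℤ) :
    latticeNorm (x + y) ≤ latticeNorm x + latticeNorm y := by
  have h : (WithLp.toLp 2 (fun i => ((x + y) i : ℝ)) : EuclideanSpace ℝ (Fin d)) =
      WithLp.toLp 2 (fun i => (x i : ℝ)) + WithLp.toLp 2 (fun i => (y i : ℝ)) := by
    ext i; simp
  rw [latticeNorm, h]
  exact norm_add_le _ _

lemma latticeNorm_add_sq {d : ℕ} (x y : Fin d → ℤ) :
    latticeNorm (x + y) ^ 2 =
      latticeNorm x ^ 2 + 2 * ∑ i, (x i : ℝ) * y i + latticeNorm y ^ 2 := by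
  simp only [latticeNorm_sq, Finset.mul_sum, ← Finset.sum_add_distrib]
  refine Finset.sum_congr rfl fun i _ => ?_
  simp only [Pi.add_apply]
  push_cast
  ring

/-- For a nearest neighbour law, `R² - ‖·‖²` decreases by one in the mean at each step. -/
lemma lintegral_parabola {d : ℕ} {θ : PMF (Fin d → ℤ)} (hθ : IsNearestNeighbourLaw θ)
    {b R : ℝ} (hb : 0 ≤ b) {x : Fin d → ℤ} (hx : latticeNorm x + 1 ≤ R) :
    ∫⁻ y, ENNReal.ofReal (1 + b * (R ^ 2 - latticeNorm (x + y) ^ 2)) ∂θ.toMeasure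
      = ENNReal.ofReal (1 + b * (R ^ 2 - latticeNorm x ^ 2 - 1)) := by
  set A := 1 + b * (R ^ 2 - latticeNorm x ^ 2 - 1) with hA
  have h1 : HasSum (fun y => (θ y).toReal) 1 := by
    have h := ENNReal.hasSum_toReal (f := θ) (by simp [PMF.tsum_coe])
    rwa [← ENNReal.tsum_toReal_eq (PMF.apply_ne_top θ), PMF.tsum_coe, ENNReal.toReal_one] at h
  have h2 : HasSum (fun y => ∑ i, (x i : ℝ) * ((y i : ℝ) * (θ y).toReal)) (∑ i, (x i : ℝ) * 0) :=
    hasSum_sum fun i _ => (hθ.centered i).mul_left _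
  have h3 := (h1.mul_left A).sub (h2.mul_left (2 * b))
  have hval : A * 1 - 2 * b * (∑ i, (x i : ℝ) * 0) = A := by simp
  rw [hval] at h3
  have hsupp : ∀ y, θ y ≠ 0 → latticeNorm y = 1 := fun y hy => by
    have : y ∈ θ.support := hy
    rwa [hθ.support_eq] at this
  have hterm : ∀ y, A * (θ y).toReal - 2 * b * ∑ i, (x i : ℝ) * ((y i : ℝ) * (θ y).toReal)
      = (1 + b * (R ^ 2 - latticeNorm (x + y) ^ 2)) * (θ y).toReal := by
    intro y
    by_cases hy : θ y = 0
    · simp [hy]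
    · simp only [← mul_assoc, ← Finset.sum_mul]
      rw [latticeNorm_add_sq, hsupp y hy, hA]
      ring
  simp only [hterm] at h3
  -- Positivity is needed since `ENNReal.ofReal` truncates at 0; it holds because a unit jump from x
  -- stays within radius R.
  have hnn : ∀ y, θ y ≠ 0 → 0 ≤ 1 + b * (R ^ 2 - latticeNorm (x + y) ^ 2) := by
    intro y hy
    have h : latticeNorm (x + y) ≤ R :=
      (latticeNorm_add_le x y).trans (by rwa [hsupp y hy])
    have := pow_le_pow_left₀ (latticeNorm_nonneg _) h 2
    have := mul_nonneg hb (sub_nonneg.2 this)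
    linarith
  rw [lintegral_countable', ← h3.tsum_eq, ENNReal.ofReal_tsum_of_nonneg _ h3.summable]
  · refine tsum_congr fun y => ?_
    rw [PMF.toMeasure_apply_singleton _ _ (measurableSet_singleton y)]
    by_cases hy : θ y = 0
    · simp [hy]
    · rw [ENNReal.ofReal_mul (hnn y hy), ENNReal.ofReal_toReal (PMF.apply_ne_top θ y)]
  · intro y
    by_cases hy : θ y = 0
    · simp [hy]
    · exact mul_nonneg (hnn y hy) ENNReal.toReal_nonneg

/-! ### The supersolution argument. -/

/-- Source of the slope 4 of the parabola: (1 + 2s)(1 + t + s/2) exceeds 1 + t by 5s/2 + 2st + s²,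
at most 5s/2 + s/2 + s = 4s. -/
lemma exp_mul_quadratic_le {K s t : ℝ} (hs : 0 ≤ s) (hs1 : s ≤ 1)
    (hKt : K * t ^ 2 ≤ s / 2) (ht : t ≤ 1 / 4) (hnn : 0 ≤ 1 + t + K * t ^ 2) :
    Real.exp s * (1 + t + K * t ^ 2) ≤ 1 + t + 4 * s := by
  have h := Real.abs_exp_sub_one_sub_id_le (x := s) (by rwa [abs_of_nonneg hs])
  have h1 : Real.exp s ≤ 1 + 2 * s := by nlinarith [(abs_le.1 h).2]
  calc Real.exp s * (1 + t + K * t ^ 2) ≤ (1 + 2 * s) * (1 + t + K * t ^ 2) := by gcongr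
    _ ≤ 1 + t + 4 * s := by nlinarith

/-- Over a ball, the exponential moments of the truncated counts are bounded by a parabola. -/
lemma lintegral_weight_le {d : ℕ} {μ : PMF ℕ} {θ : PMF (Fin d → ℤ)}
    (hθ : IsNearestNeighbourLaw θ) {K t₀ r s : ℝ} (hK : 0 ≤ K)
    (hφ : ∀ t, 0 ≤ t → t ≤ t₀ →
      ∫⁻ n, ENNReal.ofReal (1 + t) ^ n ∂μ.toMeasure ≤ ENNReal.ofReal (1 + t + K * t ^ 2))
    (hr : 1 ≤ r) (hs : 0 ≤ s) (hs1 : s ≤ 1) (ht₀ : 16 * (s * r ^ 2) ≤ t₀)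
    (h4 : 16 * (s * r ^ 2) ≤ 1 / 4) (hKs : 512 * K * (s * r ^ 4) ≤ 1) (n : ℕ) :
    ∀ x ∈ latticeBall d r, ∫⁻ ω, weight (latticeBall d r) s (n + 1) ω x ∂(law μ θ) ≤
      ENNReal.ofReal (1 + 4 * s * ((r + 1) ^ 2 - latticeNorm x ^ 2)) := by
  classical
  have hone : ∀ x ∈ latticeBall d r, 0 ≤ (r + 1) ^ 2 - latticeNorm x ^ 2 - 1 := by
    intro x hx
    have := pow_le_pow_left₀ (latticeNorm_nonneg x) (le_of_lt hx) 2
    nlinarith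
  have hstep : ∀ x ∈ latticeBall d r, ∀ H : ℝ≥0∞,
      H ≤ ENNReal.ofReal (1 + 4 * s * ((r + 1) ^ 2 - latticeNorm x ^ 2 - 1)) →
      ∫⁻ k, ENNReal.ofReal (Real.exp s) * H ^ k ∂μ.toMeasure ≤
        ENNReal.ofReal (1 + 4 * s * ((r + 1) ^ 2 - latticeNorm x ^ 2)) := by
    intro x hx H hH
    set q := (r + 1) ^ 2 - latticeNorm x ^ 2 - 1 with hq
    have hq0 : 0 ≤ q := hone x hx
    have hq1 : q ≤ 4 * r ^ 2 := by nlinarith [sq_nonneg (latticeNorm x)]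
    have ht0 : 0 ≤ 4 * s * q := by positivity
    have ht1 : 4 * s * q ≤ 16 * (s * r ^ 2) := by nlinarith
    have hsq : (4 * s * q) ^ 2 ≤ (16 * (s * r ^ 2)) ^ 2 := pow_le_pow_left₀ ht0 ht1 2
    -- This is where the normalization r⁴ enters: the quadratic error is of order s² r⁴, to be
    -- compared with s.
    have hKt : K * (4 * s * q) ^ 2 ≤ s / 2 :=
      calc K * (4 * s * q) ^ 2 ≤ K * (16 * (s * r ^ 2)) ^ 2 := by gcongr
        _ = (512 * K * (s * r ^ 4)) * (s / 2) := by ring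
        _ ≤ 1 * (s / 2) := by gcongr
        _ = s / 2 := one_mul _
    calc ∫⁻ k, ENNReal.ofReal (Real.exp s) * H ^ k ∂μ.toMeasure
        = ENNReal.ofReal (Real.exp s) * ∫⁻ k, H ^ k ∂μ.toMeasure :=
          lintegral_const_mul _ (measurable_of_countable _)
      _ ≤ ENNReal.ofReal (Real.exp s) * ENNReal.ofReal (1 + 4 * s * q + K * (4 * s * q) ^ 2) := by
          gcongr
          refine le_trans (lintegral_mono fun k => ?_) (hφ _ ht0 (ht1.trans ht₀))
          exact pow_le_pow_left' hH k
      _ ≤ ENNReal.ofReal (1 + 4 * s * ((r + 1) ^ 2 - latticeNorm x ^ 2)) := by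
          rw [← ENNReal.ofReal_mul (Real.exp_pos s).le]
          refine ENNReal.ofReal_le_ofReal ((exp_mul_quadratic_le hs hs1 hKt (ht1.trans h4)
            (by positivity)).trans (le_of_eq ?_))
          rw [hq]; ring
  -- The induction runs on the moment averaged over the jump out of x, here the otherwise unused
  -- jump of the root.
  have hH : ∀ n, ∀ x ∈ latticeBall d r,
      ∫⁻ ω, weight (latticeBall d r) s n ω (x + (ω []).2) ∂(law μ θ) ≤
        ENNReal.ofReal (1 + 4 * s * ((r + 1) ^ 2 - latticeNorm x ^ 2 - 1)) := by
    intro n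
    induction n with
    | zero =>
      intro x hx
      simp only [weight, killedCount]
      simpa using mul_nonneg (mul_nonneg zero_le_four hs) (hone x hx)
    | succ n ih =>
      intro x hx
      rw [lintegral_weight_succ μ θ _ s n (fun p => x + p.2),
        lintegral_prod_symm' _ (measurable_of_countable _),
        ← lintegral_parabola hθ (by positivity : 0 ≤ 4 * s)
          (by linarith [show latticeNorm x < r from hx] : latticeNorm x + 1 ≤ r + 1)]
      rw [lintegral_countable', lintegral_countable']
      refine ENNReal.tsum_le_tsum fun y => ?_
      rw [PMF.toMeasure_apply_singleton _ _ (measurableSet_singleton y)]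
      by_cases hy : θ y = 0
      · simp [hy]
      gcongr
      by_cases hxy : x + y ∈ latticeBall d r
      · simpa only [hxy, if_true] using hstep _ hxy _ (ih _ hxy)
      -- A particle just killed has weight 1, and the parabola is still at least 1 there since ‖x +
      -- y‖ ≤ r + 1.
      · have hy1 : latticeNorm y = 1 := by
          have : y ∈ θ.support := hy
          rwa [hθ.support_eq] at this
        have h := latticeNorm_add_le x y
        have h2 := pow_le_pow_left₀ (latticeNorm_nonneg _)
          (h.trans (by linarith [show latticeNorm x < r from hx] : _ ≤ r + 1)) 2
        simp only [hxy, if_false, lintegral_const, measure_univ, one_mul]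
        rw [← ENNReal.ofReal_one]
        refine ENNReal.ofReal_le_ofReal ?_
        have := mul_nonneg (mul_nonneg zero_le_four hs) (sub_nonneg.2 h2)
        linarith
  intro x hx
  rw [lintegral_weight_succ μ θ _ s n (fun _ => x),
    lintegral_prod_symm' _ (measurable_of_countable _)]
  simp only [hx, if_true]
  rw [lintegral_const, measure_univ, mul_one]
  exact hstep x hx _ (hH n x hx)

end BRW

theorem proposition1 (d : ℕ) (hd : 1 ≤ d) (μ : PMF ℕ) (hμ : BRW.IsCritical μ)
    (hexp : BRW.HasExpMoment μ) (θ : PMF (Fin d → ℤ)) (hθ : BRW.IsNearestNeighbourLaw θ) :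
    ∃ c lam₀ : ℝ, 0 < c ∧ 0 < lam₀ ∧
      ∀ lam : ℝ, 0 ≤ lam → lam ≤ lam₀ → ∀ r : ℝ, 1 ≤ r →
        (⨆ x ∈ BRW.latticeBall d r,
            BRW.expMomentKilled μ θ x (BRW.latticeBall d r) (lam / r ^ 4))
          ≤ ENNReal.ofReal (Real.exp (c * lam / r ^ 2)) := by
  obtain ⟨K, t₀, hK, ht₀, hφ⟩ := BRW.exists_lintegral_pow_le hμ hexp
  -- 16 is the slope 4 times the 4 in (r+1)² ≤ 4r². The three bounds on λ give t ≤ 1/4, t ≤ t₀ and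
  -- Kt² ≤ s/2, where t ≤ 16 s r²; K + 1 avoids dividing by K = 0.
  refine ⟨16, min (min (1 / 64) (t₀ / 16)) (1 / (512 * (K + 1))), by norm_num, by positivity,
    fun lam h0 hlam r hr => ?_⟩
  obtain ⟨⟨hl1, hl2⟩, hl3⟩ := (le_min_iff.1 hlam).imp_left le_min_iff.1
  rw [le_div_iff₀ (by positivity)] at hl3
  have hr0 : 0 < r := by linarith
  have hr2 : 1 ≤ r ^ 2 := one_le_pow₀ hr
  have hsr2 : lam / r ^ 4 * r ^ 2 = lam / r ^ 2 := by field_simp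
  have hsr4 : lam / r ^ 4 * r ^ 4 = lam := by field_simp
  have hlr : lam / r ^ 2 ≤ lam := div_le_self h0 hr2
  have hs1 : lam / r ^ 4 ≤ lam := div_le_self h0 (one_le_pow₀ hr)
  have hs0 : 0 ≤ lam / r ^ 4 := by positivity
  refine iSup₂_le fun x hx => BRW.expMomentKilled_le μ θ x _ hs0 fun n => ?_
  refine (BRW.lintegral_weight_le hθ hK hφ hr hs0 (by linarith) (by rw [hsr2]; linarith)
    (by rw [hsr2]; linarith) (by rw [hsr4]; nlinarith) n x hx).trans (ENNReal.ofReal_le_ofReal ?_)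
  have hq : (r + 1) ^ 2 - BRW.latticeNorm x ^ 2 ≤ 4 * r ^ 2 := by
    nlinarith [sq_nonneg (BRW.latticeNorm x)]
  calc 1 + 4 * (lam / r ^ 4) * ((r + 1) ^ 2 - BRW.latticeNorm x ^ 2)
      ≤ 1 + 4 * (lam / r ^ 4) * (4 * r ^ 2) := by gcongr
    _ = 16 * lam / r ^ 2 + 1 := by field_simp; ring
    _ ≤ Real.exp (16 * lam / r ^ 2) := Real.add_one_le_exp _
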